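/- For an irrational number $\theta$ let $a_k$ ($k\ge 1$) be the partial quotients of its regular continued fraction expansion and let $q_k$ be the denominator of its $k$-th convergent ($q_0=1$, $q_1=a_1$, $q_{k+1}=a_{k+1}q_k+q_{k-1}$). Let $\|t\|$ denote the distance from $t\in\mathbb R$ to the nearest integer. (1) If $\theta$ is an irrational number such that $\sum_{k=2}^\infty \frac1{\log q_k}<\infty$, then there is a monotone increasing sequence $\varphi(n)>0$ ($n\ge1$) such that $\sum_{n=1}^\infty \frac1{n\varphi(n)}=\infty$ and $$\liminf_{n\to\infty} n\,\varphi(n)\,\|n\theta-s\|=\infty\quad\text{for Lebesgue almost every } s\in\mathbb R .$$ Moreover $\varphi$ can be chosen so that $\varphi(n)=\log n\cdot\log\log n$ for all sufficiently large $n$. (2) The converse is not true: there is an irrational $\theta$ for which $\sum_{k=2}^\infty\frac1{\log q_k}=\infty$ although there is a monotone increasing $\varphi(n)>0$ with $\sum_{n=1}^\infty \frac1{n\varphi(n)}=\infty$ and $\liminf_{n\to\infty} n\varphi(n)\|n\theta-s\|=\infty$ for almost every $s$. In fact, this holds for every irrational $\theta$ whose partial quotients satisfy $a_k\sim k^{\log\log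 k}$ as $k\to\infty$, and such $\theta$ exist in $(0,1)$. -/

import Mathlib

open Filter Topology MeasureTheory
open scoped Asymptotics

noncomputable section

/-- The distance `‖t‖` from a real number `t` to the nearest integer. -/
def distNearestInt (t : ℝ) : ℝ := |t - (round t : ℝ)|

/-- The partial quotient `a_k` of the regular continued fraction expansion
`θ = [a_0; a_1, a_2, …]` (as a real number; the value is `0` past the end of a terminating
expansion, which does not occur for irrational `θ`). -/
def partialQuotient (θ : ℝ) : ℕ → ℝ
  | 0 => (GenContFract.of θ).h
  | k + 1 => ((GenContFract.of θ).partDens.get? k).getD 0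

/-- The denominator `q_k` of the `k`-th convergent of `θ`, so `q_0 = 1` and
`q_{k+1} = a_{k+1} q_k + q_{k-1}`. -/
def convDen (θ : ℝ) (k : ℕ) : ℝ := (GenContFract.of θ).dens k

/-- The series `∑_{k ≥ 2} 1 / log q_k` (whose terms are positive) converges. -/
def LogDenSummable (θ : ℝ) : Prop :=
  Summable fun k : ℕ => 1 / Real.log (convDen θ (k + 2))

/-- `φ(1), φ(2), …` is a monotone increasing sequence of positive numbers. -/
def IsIncreasingPos (φ : ℕ → ℝ) : Prop :=
  MonotoneOn φ (Set.Ici 1) ∧ ∀ n : ℕ, 1 ≤ n → 0 < φ n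

/-- `∑_{n ≥ 1} 1 / (n φ(n)) = ∞`. -/
def SeriesDiverges (φ : ℕ → ℝ) : Prop :=
  Tendsto (fun N : ℕ => ∑ n ∈ Finset.Icc 1 N, 1 / ((n : ℝ) * φ n)) atTop atTop

/-- `liminf_{n → ∞} n φ(n) ‖n θ - s‖ = ∞` for Lebesgue almost every real `s`. -/
def LiminfInfiniteAE (θ : ℝ) (φ : ℕ → ℝ) : Prop :=
  ∀ᵐ s : ℝ ∂volume,
    liminf (fun n : ℕ =>
      (((n : ℝ) * φ n * distNearestInt ((n : ℝ) * θ - s) : ℝ) : EReal)) atTop = ⊤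

end

/-! ### Convergents of an irrational number -/

/-! The positive results come from Borel–Cantelli on the circle, with the orbit cut into blocks `q ≤
n < b`, where `q = q_k` and `b = q_{k+1}`. Fix `M`. The bad set of a block is the union of the balls
of radius `M / (n φ n)` about `n θ`. Since `‖q θ‖ ≤ 1 / b`, the orbit in a block is nearly
`q`-periodic. Up to a cutoff `T` the centres therefore stay near the `q` points `r θ`, `r < q`, and
the balls overlap heavily: their union has measure at most `2 (T / b + M / φ q)`. Only for `n ≥ T`
are the measures added one by one (`volume_biUnion_closedBall_le`).

Let `φ n = log n · log log n · g n`. With `T = b / (log b)^2` the first term is `O(1 / (log b)^2)`.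
The sum of `1 / n` over `T ≤ n < b` is `O(log log b)`, which cancels the factor `log log` of `φ`.
The block then has measure `O(1 / (log q · g √q) + 1 / (log b · g √b))`, so convergence of `∑ 1 /
(log q_k · g √q_k)` suffices (`liminfInfiniteAE_of_summable_log`).

Taking `g = 1` gives the sufficient condition. If `a_k ~ k ^ log log k`, then `log q_k` has the
order of `k log k log log k`, so `∑ 1 / log q_k` diverges. With `g = log log log` the terms become
`O(1 / (k log k (log log k)^2))`, which is summable, while `∑ 1 / (n φ n)` still diverges, like an
iterated logarithm. -/

theorem Irrational.not_terminatedAt {θ : ℝ} (hθ : Irrational θ) (k : ℕ) :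
    ¬ (GenContFract.of θ).TerminatedAt k := by
  intro h
  obtain ⟨r, hr⟩ := (GenContFract.terminates_iff_rat θ).1 ⟨k, h⟩
  exact hθ ⟨r, hr.symm⟩

theorem exists_nat_partialQuotient {θ : ℝ} (hθ : Irrational θ) (k : ℕ) :
    ∃ b : ℕ, 1 ≤ b ∧ (GenContFract.of θ).s.get? k = some ⟨1, (b : ℝ)⟩ ∧
      (GenContFract.of θ).partDens.get? k = some (b : ℝ) ∧
      partialQuotient θ (k + 1) = b := by
  have h := hθ.not_terminatedAt k
  rw [GenContFract.terminatedAt_iff_s_none] at h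
  obtain ⟨gp, hgp⟩ := Option.ne_none_iff_exists'.1 h
  have hd := GenContFract.partDen_eq_s_b hgp
  obtain ⟨h1, z, hz⟩ := GenContFract.of_partNum_eq_one_and_exists_int_partDen_eq hgp
  have hb := GenContFract.of_one_le_get?_partDen hd
  have hz1 : 1 ≤ z := by rw [hz] at hb; exact_mod_cast hb
  obtain ⟨n, rfl⟩ := Int.eq_ofNat_of_zero_le (by lia : 0 ≤ z)
  have hgb : gp.b = (n : ℝ) := by simpa using hz
  refine ⟨n, by exact_mod_cast hz1, ?_, ?_, ?_⟩
  · rw [hgp, ← h1, ← hgb]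
  · rw [hd, hgb]
  · simp [partialQuotient, hd, hgb]

/-- The recurrence has order two, so the induction carries two consecutive continuants. -/
theorem exists_int_contsAux {θ : ℝ} (hθ : Irrational θ) (k : ℕ) :
    (∃ p q : ℤ, (GenContFract.of θ).contsAux k = ⟨(p : ℝ), (q : ℝ)⟩) ∧
      ∃ p q : ℤ, (GenContFract.of θ).contsAux (k + 1) = ⟨(p : ℝ), (q : ℝ)⟩ := by
  induction k with
  | zero => exact ⟨⟨1, 0, by simp⟩, ⟨⌊θ⌋, 1, by simp⟩⟩
  | succ k ih =>
    refine ⟨ih.2, ?_⟩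
    obtain ⟨⟨p, q, h⟩, ⟨p', q', h'⟩⟩ := ih
    obtain ⟨b, -, hs, -⟩ := exists_nat_partialQuotient hθ k
    refine ⟨b * p' + p, b * q' + q, ?_⟩
    rw [GenContFract.contsAux_recurrence hs h h']
    simp

theorem one_le_convDen {θ : ℝ} (hθ : Irrational θ) (k : ℕ) : 1 ≤ convDen θ k := by
  have := GenContFract.succ_nth_fib_le_of_nth_den (v := θ) (n := k)
    (Or.inr (hθ.not_terminatedAt _))
  refine le_trans ?_ this
  exact_mod_cast Nat.fib_pos.2 k.succ_pos

theorem exists_nat_convDen {θ : ℝ} (hθ : Irrational θ) (k : ℕ) :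
    ∃ q : ℕ, convDen θ k = q := by
  obtain ⟨-, p, q, h⟩ := exists_int_contsAux hθ k
  have hq : convDen θ k = q := by
    rw [convDen, GenContFract.den_eq_conts_b, GenContFract.nth_cont_eq_succ_nth_contAux, h]
  have h1 := one_le_convDen hθ k
  rw [hq] at h1
  have h1' : 1 ≤ q := by exact_mod_cast h1
  obtain ⟨n, rfl⟩ := Int.eq_ofNat_of_zero_le (by lia : 0 ≤ q)
  exact ⟨n, by simpa using hq⟩

theorem convDen_mono (θ : ℝ) : Monotone (convDen θ) :=
  monotone_nat_of_le_succ fun _ => GenContFract.of_den_mono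

theorem tendsto_convDen {θ : ℝ} (hθ : Irrational θ) : Tendsto (convDen θ) atTop atTop := by
  have h : Tendsto (fun k : ℕ => ((Nat.fib (k + 1) : ℕ) : ℝ)) atTop atTop := by
    refine tendsto_natCast_atTop_atTop.comp ?_
    refine tendsto_atTop_mono' atTop ?_ (tendsto_add_atTop_nat 1)
    filter_upwards [eventually_ge_atTop 4] with k hk
    exact Nat.le_fib_self (by lia)
  exact tendsto_atTop_mono (fun k => GenContFract.succ_nth_fib_le_of_nth_den (v := θ) (n := k)
    (Or.inr (hθ.not_terminatedAt _))) h

theorem partialQuotient_mul_convDen_le {θ : ℝ} (hθ : Irrational θ) (k : ℕ) :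
    partialQuotient θ (k + 1) * convDen θ k ≤ convDen θ (k + 1) := by
  obtain ⟨b, -, -, hd, hb⟩ := exists_nat_partialQuotient hθ k
  rw [hb]
  exact GenContFract.le_of_succ_get?_den hd

theorem convDen_succ_le {θ : ℝ} (hθ : Irrational θ) (k : ℕ) :
    convDen θ (k + 1) ≤ (partialQuotient θ (k + 1) + 1) * convDen θ k := by
  obtain ⟨b, -, hs, -, hb⟩ := exists_nat_partialQuotient hθ k
  rw [hb]
  cases k with
  | zero =>
    have : convDen θ 0 = 1 := GenContFract.zeroth_den_eq_one
    rw [this, convDen, GenContFract.first_den_eq hs]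
    simp
  | succ k =>
    have := GenContFract.dens_recurrence hs rfl rfl
    have hm : convDen θ k ≤ convDen θ (k + 1) := convDen_mono θ k.le_succ
    simp only [convDen] at hm ⊢
    rw [this]
    nlinarith

theorem norm_convDen_mul_le {θ : ℝ} (hθ : Irrational θ) (k : ℕ) :
    ‖((convDen θ k * θ : ℝ) : UnitAddCircle)‖ ≤ 1 / convDen θ (k + 1) := by
  obtain ⟨-, p, q, h⟩ := exists_int_contsAux hθ k
  have hp : (GenContFract.of θ).nums k = p := by
    rw [GenContFract.num_eq_conts_a, GenContFract.nth_cont_eq_succ_nth_contAux, h]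
  have h1 := GenContFract.abs_sub_convs_le (hθ.not_terminatedAt k)
  rw [GenContFract.conv_eq_num_div_den, hp] at h1
  change |θ - p / convDen θ k| ≤ 1 / (convDen θ k * convDen θ (k + 1)) at h1
  have hq : 0 < convDen θ k := one_pos.trans_le (one_le_convDen hθ k)
  have hq' : 0 < convDen θ (k + 1) := one_pos.trans_le (one_le_convDen hθ _)
  rw [UnitAddCircle.norm_eq]
  refine (round_le _ p).trans ?_
  have : convDen θ k * θ - p = convDen θ k * (θ - p / convDen θ k) := by field_simp
  rw [this, abs_mul, abs_of_pos hq]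
  calc _ ≤ convDen θ k * (1 / (convDen θ k * convDen θ (k + 1))) := by gcongr
    _ = _ := by field_simp

/-! ### The measure of a block of shrinking balls on the circle -/

/-- Writing `n = q j + r`, the points `n θ` and `r θ` differ by `j` steps of length at most `δ`. For
`n < T` there are at most `T / q` steps, so all these balls lie in `q` balls of radius `T δ / q +
ρ₀`. -/
theorem volume_biUnion_closedBall_le {θ : ℝ} {q b : ℕ} (hq : 0 < q) {δ T ρ₀ : ℝ} (hT : 0 ≤ T)
    (hδ : ‖((q * θ : ℝ) : UnitAddCircle)‖ ≤ δ) {ρ : ℕ → ℝ}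
    (hρ : ∀ n ∈ Finset.Ico q b, ρ n ≤ ρ₀) :
    volume (⋃ n ∈ Finset.Ico q b, Metric.closedBall ((n * θ : ℝ) : UnitAddCircle) (ρ n)) ≤
      ENNReal.ofReal (2 * (T * δ + q * ρ₀)) +
        ∑ n ∈ (Finset.Ico q b).filter (fun n : ℕ => T ≤ n), ENNReal.ofReal (2 * ρ n) := by
  have hδ0 : 0 ≤ δ := (norm_nonneg _).trans hδ
  have hq' : (0 : ℝ) < q := by exact_mod_cast hq
  have hball : ∀ (x : UnitAddCircle) (r : ℝ),
      volume (Metric.closedBall x r) ≤ ENNReal.ofReal (2 * r) := by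
    intro x r
    rw [AddCircle.volume_closedBall]
    exact ENNReal.ofReal_le_ofReal (min_le_right _ _)
  have hsub : (⋃ n ∈ Finset.Ico q b, Metric.closedBall ((n * θ : ℝ) : UnitAddCircle) (ρ n)) ⊆
      (⋃ r ∈ Finset.range q,
        Metric.closedBall ((r * θ : ℝ) : UnitAddCircle) (T * δ / q + ρ₀)) ∪
      ⋃ n ∈ (Finset.Ico q b).filter (fun n : ℕ => T ≤ n),
        Metric.closedBall ((n * θ : ℝ) : UnitAddCircle) (ρ n) := by
    intro s hs
    simp only [Set.mem_iUnion, exists_prop] at hs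
    obtain ⟨n, hn, hs⟩ := hs
    rcases le_or_gt T n with hTn | hTn
    · right
      simp only [Set.mem_iUnion, exists_prop]
      exact ⟨n, Finset.mem_filter.2 ⟨hn, hTn⟩, hs⟩
    · left
      simp only [Set.mem_iUnion, exists_prop]
      refine ⟨n % q, Finset.mem_range.2 (Nat.mod_lt _ hq), ?_⟩
      rw [Metric.mem_closedBall] at hs ⊢
      have hdist : dist ((n * θ : ℝ) : UnitAddCircle) (((n % q : ℕ) * θ : ℝ) : UnitAddCircle) ≤
          T * δ / q := by
        have he : (n * θ : ℝ) - ((n % q : ℕ) : ℝ) * θ = (n / q : ℕ) • (q * θ : ℝ) := by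
          have : (n : ℝ) = q * (n / q : ℕ) + (n % q : ℕ) := by exact_mod_cast (Nat.div_add_mod n q).symm
          rw [nsmul_eq_mul]
          linear_combination θ * this
        rw [dist_eq_norm, ← AddCircle.coe_sub, he, AddCircle.coe_nsmul]
        refine (norm_nsmul_le).trans ?_
        have hj : ((n / q : ℕ) : ℝ) ≤ T / q := Nat.cast_div_le.trans (by gcongr)
        calc _ ≤ T / q * δ := by gcongr
          _ = _ := by ring
      calc _ ≤ _ := dist_triangle _ _ _
        _ ≤ ρ₀ + T * δ / q := add_le_add (hs.trans (hρ n hn)) hdist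
        _ = _ := add_comm _ _
  refine (measure_mono hsub).trans ((measure_union_le _ _).trans (add_le_add ?_ ?_))
  · refine (measure_biUnion_finset_le _ _).trans ?_
    refine (Finset.sum_le_sum fun r _ => hball _ _).trans ?_
    rw [Finset.sum_const, Finset.card_range, nsmul_eq_mul, ← ENNReal.ofReal_natCast,
      ← ENNReal.ofReal_mul hq'.le]
    apply ENNReal.ofReal_le_ofReal
    apply le_of_eq
    field_simp
  · exact (measure_biUnion_finset_le _ _).trans (Finset.sum_le_sum fun r _ => hball _ _)

/-- Borel–Cantelli for the distances of `n θ` to a point of the line, the orbit being cut at the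
denominators of the convergents. -/
theorem liminfInfiniteAE_of_summable {θ : ℝ} (hθ : Irrational θ) {φ : ℕ → ℝ}
    (hφ : IsIncreasingPos φ) {h : ℝ → ℝ} (hs : Summable fun k => h (convDen θ k))
    (hvol : ∀ M : ℝ, 0 < M → ∃ C : ℝ, ∀ᶠ q : ℕ in atTop, ∀ b : ℕ, q ≤ b →
      ‖((q * θ : ℝ) : UnitAddCircle)‖ ≤ 1 / b →
      volume (⋃ n ∈ Finset.Ico q b,
        Metric.closedBall ((n * θ : ℝ) : UnitAddCircle) (M / (n * φ n))) ≤
        ENNReal.ofReal (C * (h q + h b))) :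
    LiminfInfiniteAE θ φ := by
  choose Q hQ using exists_nat_convDen hθ
  have hQmono : Monotone Q := by
    intro i j hij
    have := convDen_mono θ hij
    rw [hQ, hQ] at this
    exact_mod_cast this
  have hQtop : Tendsto Q atTop atTop := by
    have := tendsto_convDen hθ
    rw [show convDen θ = fun k => (Q k : ℝ) from funext hQ] at this
    exact tendsto_natCast_atTop_iff.1 this
  have hcircle : ∀ M : ℝ, 0 < M → ∀ᵐ s : UnitAddCircle ∂volume, ∀ᶠ n : ℕ in atTop,
      M / (n * φ n) < dist s ((n * θ : ℝ) : UnitAddCircle) := by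
    intro M hM
    obtain ⟨C, hC⟩ := hvol M hM
    let E : ℕ → Set UnitAddCircle := fun k => ⋃ n ∈ Finset.Ico (Q k) (Q (k + 1)),
      Metric.closedBall ((n * θ : ℝ) : UnitAddCircle) (M / (n * φ n))
    obtain ⟨K, hK⟩ := eventually_atTop.1 (hQtop.eventually hC)
    have hE : ∀ k, K ≤ k → volume (E k) ≤
        ENNReal.ofReal (C * (h (convDen θ k) + h (convDen θ (k + 1)))) := by
      intro k hk
      rw [hQ, hQ]
      refine hK k hk (Q (k + 1)) (hQmono k.le_succ) ?_
      rw [← hQ, ← hQ]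
      exact norm_convDen_mul_le hθ k
    have hsum : Summable fun k => C * (h (convDen θ k) + h (convDen θ (k + 1))) :=
      (hs.add ((summable_nat_add_iff 1).2 hs)).mul_left C
    have hfin : ∑' k, volume (E (k + K)) ≠ ⊤ := by
      refine ne_top_of_le_ne_top ?_ (ENNReal.tsum_le_tsum fun k => hE (k + K) (by lia))
      exact ((summable_nat_add_iff K).2 hsum).tsum_ofReal_ne_top
    have h0 := ae_eventually_notMem hfin
    filter_upwards [h0] with s hs
    obtain ⟨k₀, hk₀⟩ := eventually_atTop.1 hs
    filter_upwards [eventually_ge_atTop (Q (k₀ + K))] with n hn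
    have hex : ∃ k, n < Q (k + 1) :=
      (((tendsto_add_atTop_iff_nat 1).2 hQtop).eventually_gt_atTop n).exists
    classical
    let k := Nat.find hex
    have hk1 : n < Q (k + 1) := Nat.find_spec hex
    have hkK : k₀ + K ≤ k := by
      by_contra hlt
      have : Q (k + 1) ≤ Q (k₀ + K) := hQmono (by lia)
      lia
    have hk2 : Q k ≤ n := by
      -- Minimality of `k` says nothing when `k = 0`; then `k₀ + K = 0` and the lower bound imposed
      -- on `n` is used instead.
      rcases Nat.eq_zero_or_pos k with h0 | h0
      · have : k₀ + K = k := by lia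
        rw [← this]; exact hn
      · have := Nat.find_min hex (Nat.sub_lt h0 one_pos)
        rw [Nat.sub_add_cancel (show 1 ≤ Nat.find hex from h0)] at this
        exact not_lt.1 this
    have := hk₀ (k - K) (by lia)
    rw [Nat.sub_add_cancel (by lia)] at this
    by_contra hcon
    apply this
    simp only [E, Set.mem_iUnion, exists_prop]
    exact ⟨n, Finset.mem_Ico.2 ⟨hk2, hk1⟩, Metric.mem_closedBall.2 (not_lt.1 hcon)⟩
  have hall : ∀ᵐ s : UnitAddCircle ∂volume, ∀ m : ℕ, ∀ᶠ n : ℕ in atTop,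
      ((m : ℝ) + 1) / (n * φ n) < dist s ((n * θ : ℝ) : UnitAddCircle) :=
    ae_all_iff.2 fun m => hcircle _ (by positivity)
  have hpull : ∀ᵐ s : ℝ ∂volume, ∀ m : ℕ, ∀ᶠ n : ℕ in atTop,
      ((m : ℝ) + 1) / (n * φ n) < dist (s : UnitAddCircle) ((n * θ : ℝ) : UnitAddCircle) := by
    -- The quotient map preserves measure on each unit interval, and countably many of these cover
    -- the line.
    have hr : ∀ z : ℤ, ∀ᵐ s : ℝ ∂(volume.restrict (Set.Ioc (z : ℝ) (z + 1))), ∀ m : ℕ,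
        ∀ᶠ n : ℕ in atTop, ((m : ℝ) + 1) / (n * φ n) <
          dist (s : UnitAddCircle) ((n * θ : ℝ) : UnitAddCircle) := fun z =>
      (UnitAddCircle.measurePreserving_mk (z : ℝ)).quasiMeasurePreserving.ae hall
    rw [← Measure.restrict_univ (μ := (volume : Measure ℝ)), ← iUnion_Ioc_intCast ℝ]
    exact (ae_restrict_iUnion_iff _ _).2 hr
  filter_upwards [hpull] with s hs
  apply Tendsto.liminf_eq
  rw [EReal.tendsto_nhds_top_iff_real]
  intro x
  obtain ⟨m, hm⟩ := exists_nat_gt x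
  filter_upwards [hs m, eventually_ge_atTop 1] with n hn hn1
  rw [EReal.coe_lt_coe_iff]
  have hpos : 0 < (n : ℝ) * φ n := mul_pos (by exact_mod_cast hn1) (hφ.2 n hn1)
  rw [dist_comm, dist_eq_norm, ← AddCircle.coe_sub, UnitAddCircle.norm_eq, div_lt_iff₀ hpos] at hn
  rw [distNearestInt, mul_comm]
  linarith

/-- Telescoping: `1 / n ≤ 2 / (n + 1) ≤ 2 (log (n + 1) - log n)`. -/
theorem sum_inv_nat_le_log {T : ℝ} (hT : 0 < T) {q b : ℕ} (hTb : T ≤ b) :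
    ∑ n ∈ (Finset.Ico q b).filter (fun n : ℕ => T ≤ n), 1 / (n : ℝ) ≤
      2 * Real.log (b / T) := by
  have hc : (0 : ℝ) < ⌈T⌉₊ := hT.trans_le (Nat.le_ceil T)
  have hcb : ⌈T⌉₊ ≤ b := Nat.ceil_le.2 hTb
  have hb : (0 : ℝ) < b := hT.trans_le hTb
  calc ∑ n ∈ (Finset.Ico q b).filter (fun n : ℕ => T ≤ n), 1 / (n : ℝ)
      ≤ ∑ n ∈ Finset.Ico ⌈T⌉₊ b, 1 / (n : ℝ) := by
        refine Finset.sum_le_sum_of_subset_of_nonneg ?_ fun _ _ _ => by positivity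
        intro n hn
        simp only [Finset.mem_filter, Finset.mem_Ico] at hn ⊢
        exact ⟨Nat.ceil_le.2 hn.2, hn.1.2⟩
    _ ≤ ∑ n ∈ Finset.Ico ⌈T⌉₊ b,
          (2 * Real.log ((n + 1 : ℕ) : ℝ) - 2 * Real.log (n : ℝ)) := by
        refine Finset.sum_le_sum fun n hn => ?_
        have hn0 : (0 : ℝ) < n := hc.trans_le (by exact_mod_cast (Finset.mem_Ico.1 hn).1)
        have hn1 : (1 : ℝ) ≤ n := by exact_mod_cast Nat.cast_pos.1 hn0
        have h1 := Real.one_sub_inv_le_log_of_pos (x := ((n + 1 : ℕ) : ℝ) / n) (by positivity)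
        rw [Real.log_div (by positivity) hn0.ne'] at h1
        have h2 : 1 / (n : ℝ) ≤ 2 * (1 - (((n + 1 : ℕ) : ℝ) / n)⁻¹) := by
          push_cast
          rw [inv_div, one_sub_div (by positivity), mul_div_assoc', div_le_div_iff₀ hn0 (by positivity)]
          linarith
        linarith
    _ = 2 * Real.log b - 2 * Real.log (⌈T⌉₊ : ℝ) :=
        Finset.sum_Ico_sub (fun n : ℕ => 2 * Real.log (n : ℝ)) hcb
    _ ≤ 2 * Real.log (b / T) := by
        rw [Real.log_div hb.ne' hT.ne']
        have := Real.log_le_log hT (Nat.le_ceil T)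
        linarith

theorem Real.eventually_four_mul_log_le : ∀ᶠ x : ℝ in atTop, 4 * Real.log x ≤ x := by
  filter_upwards [Real.isLittleO_log_id_atTop.bound (show (0 : ℝ) < 1 / 4 by norm_num),
    eventually_ge_atTop 1] with x hx h1
  rw [Real.norm_of_nonneg (Real.log_nonneg h1), id, Real.norm_of_nonneg (by linarith)] at hx
  linarith

theorem tendsto_log_natCast : Tendsto (fun n : ℕ => Real.log n) atTop atTop :=
  Real.tendsto_log_atTop.comp tendsto_natCast_atTop_atTop

theorem Real.log_sqrt_le_log {x : ℝ} (hx : 1 ≤ x) : Real.log (√x) ≤ Real.log x := by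
  rw [Real.log_sqrt (by linarith)]
  linarith [Real.log_nonneg hx]

/-- The cutoff `T = b / (log b)^2` balances the two terms of the block estimate. As `T ≥ √b`, every
`n ≥ T` has `log n` and `log log n` at least half their values at `b`, and `g n ≥ g √b`; hence the
square roots in the bound. -/
theorem eventually_volume_biUnion_closedBall_le {θ : ℝ} {φ : ℕ → ℝ} (hφ : IsIncreasingPos φ)
    {g : ℝ → ℝ} {x₀ : ℝ} (hg : MonotoneOn g (Set.Ici x₀)) (hg0 : ∀ x, x₀ ≤ x → 0 < g x)
    (hgl : ∀ x, x₀ ≤ x → g x ≤ Real.log x)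
    (hφg : ∀ᶠ n : ℕ in atTop, φ n = Real.log n * Real.log (Real.log n) * g n)
    {M : ℝ} (hM : 0 < M) :
    ∃ C : ℝ, ∀ᶠ q : ℕ in atTop, ∀ b : ℕ, q ≤ b →
      ‖((q * θ : ℝ) : UnitAddCircle)‖ ≤ 1 / b →
      volume (⋃ n ∈ Finset.Ico q b,
        Metric.closedBall ((n * θ : ℝ) : UnitAddCircle) (M / (n * φ n))) ≤
        ENNReal.ofReal (C * (1 / (Real.log q * g (√q)) + 1 / (Real.log b * g (√b)))) := by
  -- The `2` pays for the drift `T / b`, and `32 * M` for the tail `n ≥ T`; the latter also covers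
  -- the `2 * M` from the initial radius.
  refine ⟨32 * M + 2, ?_⟩
  obtain ⟨N, hN⟩ := eventually_atTop.1 hφg
  have hsqrt : Tendsto (fun n : ℕ => √(n : ℝ)) atTop atTop :=
    Real.tendsto_sqrt_atTop.comp tendsto_natCast_atTop_atTop
  have hlarge : ∀ᶠ q : ℕ in atTop, ∀ b : ℕ, q ≤ b →
      1 ≤ b ∧ N ≤ b ∧ x₀ ≤ √(b : ℝ) ∧ (N : ℝ) ≤ √(b : ℝ) ∧
        4 * Real.log (Real.log b) ≤ Real.log b ∧ 16 ≤ Real.log b ∧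
        1 ≤ Real.log (Real.log b) :=
    eventually_forall_ge_atTop.2 <| by
      filter_upwards [eventually_ge_atTop 1, eventually_ge_atTop N,
        hsqrt.eventually_ge_atTop x₀, hsqrt.eventually_ge_atTop N,
        tendsto_log_natCast.eventually Real.eventually_four_mul_log_le,
        tendsto_log_natCast.eventually_ge_atTop 16,
        (Real.tendsto_log_atTop.comp tendsto_log_natCast).eventually_ge_atTop 1]
        with b h1 h2 h3 h4 h5 h6 h7
      exact ⟨h1, h2, h3, h4, h5, h6, h7⟩
  filter_upwards [hlarge] with q hql b hqb hδ
  obtain ⟨hq1, hqN, hqx, hqN', -, hqL, hqLL⟩ := hql q le_rfl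
  obtain ⟨hb1, hbN, hbx, hbN', hb4, hbL, hbLL⟩ := hql b hqb
  have hqR : (1 : ℝ) ≤ q := by exact_mod_cast hq1
  have hbR : (1 : ℝ) ≤ b := by exact_mod_cast hb1
  have hsqrt_le : ∀ x : ℝ, 1 ≤ x → √x ≤ x := fun x hx =>
    Real.sqrt_le_iff.2 ⟨by linarith, by nlinarith⟩
  have hgq : 0 < g (√q) := hg0 _ hqx
  have hgb : 0 < g (√b) := hg0 _ hbx
  set L := Real.log b with hLdef
  set T := (b : ℝ) / L ^ 2 with hTdef
  have hL0 : 0 < L := by linarith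
  have hT0 : 0 < T := by positivity
  have hlogT : Real.log (b / T) = 2 * Real.log L := by
    have : (b : ℝ) / T = L ^ 2 := by rw [hTdef]; field_simp
    rw [this, Real.log_pow]; norm_num
  have hTb : T ≤ b := div_le_self (by positivity) (by nlinarith)
  -- In logarithms this reads `L / 2 ≤ L - 2 log L`, that is `4 log L ≤ L`.
  have hTsqrt : √(b : ℝ) ≤ T := by
    rw [← Real.log_le_log_iff (by positivity) hT0, Real.log_sqrt (by positivity), hTdef,
      Real.log_div (by positivity) (by positivity), Real.log_pow]
    push_cast
    linarith
  have hφpos : ∀ n : ℕ, 1 ≤ n → 0 < (n : ℝ) * φ n := fun n hn =>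
    mul_pos (by exact_mod_cast hn) (hφ.2 n hn)
  have hρ : ∀ n ∈ Finset.Ico q b, M / (n * φ n) ≤ M / (q * φ q) := by
    intro n hn
    have hqn := (Finset.mem_Ico.1 hn).1
    have h1 := hφ.1 (Set.mem_Ici.2 hq1) (Set.mem_Ici.2 (hq1.trans hqn)) hqn
    have h2 := hφ.2 q hq1
    have := hφpos q hq1
    gcongr
  refine (volume_biUnion_closedBall_le hq1 hT0.le hδ hρ).trans ?_
  have hterm : ∀ n ∈ (Finset.Ico q b).filter (fun n : ℕ => T ≤ n),
      2 * (M / (n * φ n)) ≤ 8 * M / (L * Real.log L * g (√b)) * (1 / n) := by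
    intro n hn
    obtain ⟨hnI, hTn⟩ := Finset.mem_filter.1 hn
    have hqn := (Finset.mem_Ico.1 hnI).1
    have hbn : √(b : ℝ) ≤ n := hTsqrt.trans hTn
    have hnN : N ≤ n := by exact_mod_cast hbN'.trans hbn
    have hn0 : (0 : ℝ) < n := hT0.trans_le hTn
    have hlog : L / 2 ≤ Real.log n := by
      rw [hLdef, ← Real.log_sqrt (by positivity)]
      exact Real.log_le_log (by positivity) hbn
    have hloglog : Real.log L / 2 ≤ Real.log (Real.log n) := by
      refine le_trans ?_ (Real.log_le_log (by positivity) hlog)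
      rw [Real.log_div hL0.ne' two_ne_zero]
      have : Real.log 2 ≤ Real.log L / 2 := by
        have h4 : Real.log (2 ^ 2) ≤ Real.log L := Real.log_le_log (by norm_num) (by linarith)
        rw [Real.log_pow] at h4
        push_cast at h4
        linarith
      linarith
    have hlogn : 0 < Real.log n := by linarith
    have hloglogn : 0 < Real.log (Real.log n) := by linarith
    have hgn : g (√b) ≤ g n := hg hbx (hbx.trans hbn) hbn
    have hφn : L * Real.log L * g (√b) / 4 ≤ φ n := by
      rw [hN n hnN]
      calc _ = L / 2 * (Real.log L / 2) * g (√b) := by ring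
        _ ≤ _ := by gcongr
    calc 2 * (M / (n * φ n)) ≤ 2 * (M / (n * (L * Real.log L * g (√b) / 4))) := by
          have : 0 < L * Real.log L * g (√b) / 4 := by positivity
          gcongr
      _ = _ := by field_simp; norm_num
  have hsum : ∑ n ∈ (Finset.Ico q b).filter (fun n : ℕ => T ≤ n),
      ENNReal.ofReal (2 * (M / (n * φ n))) ≤ ENNReal.ofReal (32 * M / (L * g (√b))) := by
    rw [← ENNReal.ofReal_sum_of_nonneg]
    · apply ENNReal.ofReal_le_ofReal
      refine (Finset.sum_le_sum hterm).trans ?_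
      rw [← Finset.mul_sum]
      have hlogL : 0 < Real.log L := by linarith
      calc _ ≤ 8 * M / (L * Real.log L * g (√b)) * (2 * Real.log (b / T)) := by
            gcongr
            exact sum_inv_nat_le_log hT0 hTb
        _ = _ := by rw [hlogT]; field_simp; norm_num
    · intro n hn
      have hqn := (Finset.mem_Ico.1 (Finset.mem_filter.1 hn).1).1
      have := hφpos n (hq1.trans hqn)
      positivity
  have hfirst : 2 * (T * (1 / b) + q * (M / (q * φ q))) ≤
      2 / (L * g (√b)) + 2 * M / (Real.log q * g (√q)) := by
    have h1 : T * (1 / b) ≤ 1 / (L * g (√b)) := by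
      have hgL : g (√b) ≤ L := (hgl _ hbx).trans (Real.log_sqrt_le_log hbR)
      calc T * (1 / b) = 1 / (L * L) := by rw [hTdef]; field_simp
        _ ≤ _ := by gcongr
    have h2 : q * (M / (q * φ q)) ≤ M / (Real.log q * g (√q)) := by
      have h3 : Real.log q * g (√q) ≤ φ q := by
        rw [hN q hqN]
        have := hg hqx (hqx.trans (hsqrt_le q hqR)) (hsqrt_le q hqR)
        have hlq : 0 < Real.log q := by linarith
        calc Real.log q * g (√q) ≤ Real.log q * 1 * g q := by rw [mul_one]; gcongr
          _ ≤ _ := by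
            have : 0 ≤ g q := hgq.le.trans this
            gcongr
      calc (q : ℝ) * (M / (q * φ q)) = M / φ q := by
            have := hφ.2 q hq1
            field_simp
        _ ≤ _ := by
            have hlq : 0 < Real.log q := by linarith
            gcongr
    have e1 : 2 / (L * g (√b)) = 2 * (1 / (L * g (√b))) := by ring
    have e2 : 2 * M / (Real.log q * g (√q)) = 2 * (M / (Real.log q * g (√q))) := by ring
    rw [e1, e2]
    linarith
  have hlq : 0 < Real.log q := by linarith
  refine (add_le_add (ENNReal.ofReal_le_ofReal hfirst) hsum).trans ?_
  rw [← ENNReal.ofReal_add (by positivity) (by positivity)]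
  apply ENNReal.ofReal_le_ofReal
  have p1 : 0 < 1 / (Real.log q * g (√q)) := by positivity
  have p2 : 0 < 1 / (L * g (√b)) := by positivity
  have e1 : 2 / (L * g (√b)) = 2 * (1 / (L * g (√b))) := by ring
  have e2 : 2 * M / (Real.log q * g (√q)) = 2 * M * (1 / (Real.log q * g (√q))) := by ring
  have e3 : 32 * M / (L * g (√b)) = 32 * M * (1 / (L * g (√b))) := by ring
  rw [e1, e2, e3]
  nlinarith [mul_pos hM p1, mul_pos hM p2]

/-- A sequence which is eventually `log n · log log n · g(n)` is admissible as soon as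
`∑ 1 / (log q_k · g(√q_k))` converges. -/
theorem liminfInfiniteAE_of_summable_log {θ : ℝ} (hθ : Irrational θ) {φ : ℕ → ℝ}
    (hφ : IsIncreasingPos φ) {g : ℝ → ℝ} {x₀ : ℝ} (hg : MonotoneOn g (Set.Ici x₀))
    (hg0 : ∀ x, x₀ ≤ x → 0 < g x) (hgl : ∀ x, x₀ ≤ x → g x ≤ Real.log x)
    (hφg : ∀ᶠ n : ℕ in atTop, φ n = Real.log n * Real.log (Real.log n) * g n)
    (hs : Summable fun k => 1 / (Real.log (convDen θ k) * g (√(convDen θ k)))) :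
    LiminfInfiniteAE θ φ :=
  liminfInfiniteAE_of_summable hθ hφ (h := fun x => 1 / (Real.log x * g (√x))) hs fun _ hM =>
    eventually_volume_biUnion_closedBall_le hφ hg hg0 hgl hφg hM

/-! ### Telescoping series of iterated logarithms -/

theorem tendsto_sum_range_atTop_of_sub_le {f G : ℕ → ℝ} (hG : Tendsto G atTop atTop)
    (h : ∀ᶠ k in atTop, G (k + 1) - G k ≤ f k) :
    Tendsto (fun n => ∑ k ∈ Finset.range n, f k) atTop atTop := by
  obtain ⟨N, hN⟩ := eventually_atTop.1 h
  refine tendsto_atTop_mono' atTop ?_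
    (tendsto_atTop_add_const_right atTop (∑ k ∈ Finset.range N, f k - G N) hG)
  filter_upwards [eventually_ge_atTop N] with n hn
  have h1 : ∑ k ∈ Finset.Ico N n, (G (k + 1) - G k) ≤ ∑ k ∈ Finset.Ico N n, f k :=
    Finset.sum_le_sum fun k hk => hN k (Finset.mem_Ico.1 hk).1
  rw [Finset.sum_Ico_sub _ hn, Finset.sum_Ico_eq_sub _ hn] at h1
  linarith

theorem not_summable_of_sub_le {f G : ℕ → ℝ} (hG : Tendsto G atTop atTop)
    (h : ∀ᶠ k in atTop, G (k + 1) - G k ≤ f k) : ¬ Summable f := fun hs =>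
  not_tendsto_nhds_of_tendsto_atTop (tendsto_sum_range_atTop_of_sub_le hG h) _
    hs.hasSum.tendsto_sum_nat

theorem seriesDiverges_of_sub_le {φ G : ℕ → ℝ} (hG : Tendsto G atTop atTop)
    (h : ∀ᶠ k : ℕ in atTop, G (k + 1) - G k ≤ 1 / (k * φ k)) : SeriesDiverges φ := by
  refine ((tendsto_add_atTop_iff_nat 1).2 (tendsto_sum_range_atTop_of_sub_le hG h)).congr
    fun n => ?_
  -- The extra term at index `0` is a division by zero and vanishes.
  rw [Finset.range_eq_Ico, Finset.sum_eq_sum_Ico_succ_bot n.succ_pos]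
  simp only [Nat.cast_zero, zero_mul, div_zero, zero_add]
  rfl

theorem summable_of_le_sub {f H : ℕ → ℝ} (hH : ∀ᶠ k in atTop, 0 ≤ H k)
    (h0 : ∀ᶠ k in atTop, 0 ≤ f k) (h : ∀ᶠ k in atTop, f k ≤ H k - H (k + 1)) :
    Summable f := by
  obtain ⟨N, hN⟩ := eventually_atTop.1 (hH.and (h0.and h))
  rw [← summable_nat_add_iff N]
  refine summable_of_sum_range_le (c := H N) (fun k => (hN (k + N) (by lia)).2.1) fun n => ?_
  have h1 : ∑ k ∈ Finset.range n, f (k + N) ≤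
      ∑ k ∈ Finset.range n, (H (k + N) - H (k + 1 + N)) :=
    Finset.sum_le_sum fun k _ => by
      have := (hN (k + N) (by lia)).2.2
      rwa [add_right_comm] at this
  rw [Finset.sum_range_sub' (fun k => H (k + N))] at h1
  have := (hN (n + N) (by lia)).1
  simp only [zero_add] at h1
  linarith

theorem Real.log_sub_log_le {a b : ℝ} (ha : 0 < a) (hb : 0 < b) :
    Real.log b - Real.log a ≤ (b - a) / a := by
  rw [← Real.log_div hb.ne' ha.ne', sub_div, div_self ha.ne']
  exact Real.log_le_sub_one_of_pos (by positivity)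

theorem Real.div_le_log_sub_log {a b : ℝ} (ha : 0 < a) (hb : 0 < b) :
    (b - a) / b ≤ Real.log b - Real.log a := by
  have h := Real.log_sub_log_le hb ha
  have e : (a - b) / b = -((b - a) / b) := by ring
  rw [e] at h
  linarith

/-- A discrete chain rule, from `log y - log x ≤ (y - x) / x`. Iterating it bounds the increments of
all iterated logarithms. -/
theorem log_succ_sub_log_le {u : ℕ → ℝ} (hu : Tendsto u atTop atTop) {v : ℕ → ℝ}
    (h : ∀ᶠ k in atTop, u (k + 1) - u k ≤ 1 / v k) :
    ∀ᶠ k in atTop, Real.log (u (k + 1)) - Real.log (u k) ≤ 1 / (v k * u k) := by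
  filter_upwards [h, hu.eventually_gt_atTop 0,
    ((tendsto_add_atTop_iff_nat 1).2 hu).eventually_gt_atTop 0] with k hk h0 h1
  refine (Real.log_sub_log_le h0 h1).trans ?_
  rw [← div_div]
  gcongr

theorem tendsto_loglog_natCast : Tendsto (fun n : ℕ => Real.log (Real.log n)) atTop atTop :=
  Real.tendsto_log_atTop.comp tendsto_log_natCast

theorem tendsto_logloglog_natCast :
    Tendsto (fun n : ℕ => Real.log (Real.log (Real.log n))) atTop atTop :=
  Real.tendsto_log_atTop.comp tendsto_loglog_natCast

theorem eventually_logloglog_succ_sub_le : ∀ᶠ k : ℕ in atTop,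
    Real.log (Real.log (Real.log ((k + 1 : ℕ) : ℝ))) - Real.log (Real.log (Real.log k)) ≤
      1 / (k * Real.log k * Real.log (Real.log k)) := by
  have h1 : ∀ᶠ k : ℕ in atTop, ((k + 1 : ℕ) : ℝ) - k ≤ 1 / 1 :=
    Eventually.of_forall fun k => by push_cast; linarith
  have h2 := log_succ_sub_log_le tendsto_natCast_atTop_atTop (v := fun _ => 1) h1
  simp only [one_mul] at h2
  exact log_succ_sub_log_le tendsto_loglog_natCast (log_succ_sub_log_le tendsto_log_natCast h2)

theorem eventually_loglogloglog_succ_sub_le : ∀ᶠ k : ℕ in atTop,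
    Real.log (Real.log (Real.log (Real.log ((k + 1 : ℕ) : ℝ)))) -
        Real.log (Real.log (Real.log (Real.log k))) ≤
      1 / (k * Real.log k * Real.log (Real.log k) * Real.log (Real.log (Real.log k))) :=
  log_succ_sub_log_le tendsto_logloglog_natCast eventually_logloglog_succ_sub_le

/-- The term at `k + 1` is at most the drop of `1 / log log` from `k` to `k + 1`, hence the index
shift. -/
theorem summable_one_div_mul_log_mul_loglog_sq : Summable fun k : ℕ =>
    1 / (k * Real.log k * Real.log (Real.log k) ^ 2) := by
  rw [← summable_nat_add_iff 1]
  refine summable_of_le_sub (H := fun k => 1 / Real.log (Real.log k)) ?_ ?_ ?_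
  · filter_upwards [tendsto_loglog_natCast.eventually_gt_atTop 0] with k hk
    positivity
  · filter_upwards [((tendsto_add_atTop_iff_nat 1).2 tendsto_log_natCast).eventually_gt_atTop 0]
      with k hk
    positivity
  · filter_upwards [eventually_gt_atTop 0, tendsto_log_natCast.eventually_gt_atTop 0,
      tendsto_loglog_natCast.eventually_gt_atTop 0,
      ((tendsto_add_atTop_iff_nat 1).2 tendsto_log_natCast).eventually_gt_atTop 0,
      ((tendsto_add_atTop_iff_nat 1).2 tendsto_loglog_natCast).eventually_gt_atTop 0]
      with k h1 h2 h3 h4 h5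
    have hk : (0 : ℝ) < k := by exact_mod_cast h1
    have hk' : (0 : ℝ) < (k + 1 : ℕ) := by positivity
    have hle : Real.log k ≤ Real.log (k + 1 : ℕ) := Real.log_le_log hk (by push_cast; linarith)
    have e1 := Real.div_le_log_sub_log hk hk'
    have e2 := Real.div_le_log_sub_log h2 h4
    have e3 : Real.log (Real.log k) ≤ Real.log (Real.log (k + 1 : ℕ)) :=
      Real.log_le_log h2 hle
    set a := Real.log (Real.log k)
    set b := Real.log (Real.log (k + 1 : ℕ))
    have e4 : 1 / (((k + 1 : ℕ) : ℝ) * Real.log (k + 1 : ℕ)) ≤ b - a := by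
      refine le_trans ?_ e2
      rw [← div_div]
      gcongr
      refine le_trans (le_of_eq ?_) e1
      push_cast
      ring
    calc 1 / (((k + 1 : ℕ) : ℝ) * Real.log (k + 1 : ℕ) * b ^ 2)
        = 1 / (((k + 1 : ℕ) : ℝ) * Real.log (k + 1 : ℕ)) / b ^ 2 := by rw [div_div]
      _ ≤ (b - a) / b ^ 2 := by gcongr
      _ ≤ (b - a) / (a * b) := by
          have : 0 ≤ b - a := by linarith
          gcongr
          nlinarith
      _ = 1 / a - 1 / b := by field_simp

/-- A positive increasing function of a large real variable gives an admissible sequence. -/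
theorem exists_isIncreasingPos {F : ℝ → ℝ} {x₀ : ℝ} (hF : MonotoneOn F (Set.Ici x₀))
    (h0 : 0 < F x₀) : ∃ φ : ℕ → ℝ, (∀ᶠ n : ℕ in atTop, φ n = F n) ∧ IsIncreasingPos φ := by
  refine ⟨fun n => F (max n x₀), ?_, fun m _ n _ hmn => ?_, fun n _ => ?_⟩
  · filter_upwards [tendsto_natCast_atTop_atTop.eventually_ge_atTop x₀] with n hn
    simp only [max_eq_left hn]
  · refine hF (Set.mem_Ici.2 (le_max_right _ _)) (Set.mem_Ici.2 (le_max_right _ _)) (max_le_max_right _ ?_)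
    exact_mod_cast hmn
  · exact h0.trans_le (hF (Set.mem_Ici.2 le_rfl) (Set.mem_Ici.2 (le_max_right _ _)) (le_max_right _ _))

theorem Real.le_log_of_exp_le {x c : ℝ} (h : Real.exp c ≤ x) : c ≤ Real.log x :=
  (Real.le_log_iff_exp_le ((Real.exp_pos c).trans_le h)).2 h

theorem monotoneOn_log_mul_loglog :
    MonotoneOn (fun x => Real.log x * Real.log (Real.log x)) (Set.Ici (Real.exp (Real.exp 1))) := by
  intro x hx y hy hxy
  have h1 : Real.exp 1 ≤ Real.log x := Real.le_log_of_exp_le hx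
  have h2 : 1 ≤ Real.log (Real.log x) := Real.le_log_of_exp_le h1
  have h3 : 0 < Real.log x := (Real.exp_pos 1).trans_le h1
  have h4 : Real.log x ≤ Real.log y := Real.log_le_log ((Real.exp_pos _).trans_le hx) hxy
  have h5 := Real.log_le_log h3 h4
  have h6 : 0 < Real.log y := h3.trans_le h4
  exact mul_le_mul h4 h5 (by linarith) h6.le

/-! ### The sufficient condition -/

theorem exists_log_mul_loglog_of_logDenSummable {θ : ℝ} (hθ : Irrational θ)
    (hs : LogDenSummable θ) : ∃ φ : ℕ → ℝ,
      (∀ᶠ n : ℕ in atTop, φ n = Real.log n * Real.log (Real.log n)) ∧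
      IsIncreasingPos φ ∧ SeriesDiverges φ ∧ LiminfInfiniteAE θ φ := by
  obtain ⟨φ, hφ, hinc⟩ := exists_isIncreasingPos monotoneOn_log_mul_loglog (by simp; positivity)
  refine ⟨φ, hφ, hinc, ?_, ?_⟩
  · refine seriesDiverges_of_sub_le tendsto_logloglog_natCast ?_
    filter_upwards [hφ, eventually_logloglog_succ_sub_le] with n h1 h2
    rwa [h1, ← mul_assoc]
  · refine liminfInfiniteAE_of_summable_log hθ hinc (g := fun _ => 1) (x₀ := Real.exp 1)
      monotoneOn_const (fun _ _ => one_pos) (fun x hx => Real.le_log_of_exp_le hx) ?_ ?_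
    · simpa only [mul_one] using hφ
    · simp only [mul_one]
      exact (summable_nat_add_iff 2).1 hs

/-! ### Irrational numbers with prescribed partial quotients -/

/-- Here `y n` plays the role of the tail `[0; a n, a (n + 1), …]`. Finitely many of the equations
can be solved backwards from an arbitrary last value. Each is a closed condition on the compact cube
`[0, 1]^ℕ`, so by compactness all hold at once. -/
theorem exists_seq_eq_inv_add (a : ℕ → ℕ) (ha : ∀ n, 1 ≤ a n) :
    ∃ y : ℕ → ℝ, (∀ n, y n ∈ Set.Icc (0 : ℝ) 1) ∧ ∀ n, y n * (a n + y (n + 1)) = 1 := by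
  have hfin : ∀ N : ℕ, ∀ a : ℕ → ℕ, (∀ n, 1 ≤ a n) → ∃ y : ℕ → ℝ,
      (∀ n, y n ∈ Set.Icc (0 : ℝ) 1) ∧ ∀ n < N, y n * (a n + y (n + 1)) = 1 := by
    intro N
    induction N with
    | zero => exact fun a _ => ⟨fun _ => 0, fun _ => by simp, fun n hn => by lia⟩
    | succ N ih =>
      intro a ha
      obtain ⟨y, hy, hy'⟩ := ih (fun n => a (n + 1)) (fun n => ha _)
      have ha0 : (1 : ℝ) ≤ a 0 := by exact_mod_cast ha 0
      have hd : 1 ≤ (a 0 : ℝ) + y 0 := by linarith [(hy 0).1]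
      refine ⟨fun n => Nat.casesOn n (1 / (a 0 + y 0)) y, ?_, ?_⟩
      · rintro (_ | n)
        · exact ⟨one_div_nonneg.2 (by linarith), (div_le_one (by linarith)).2 hd⟩
        · exact hy n
      · rintro (_ | n) hn
        · exact one_div_mul_cancel (by linarith)
        · exact hy' n (by lia)
  let S : ℕ → Set (ℕ → ℝ) := fun N =>
    Set.univ.pi (fun _ => Set.Icc (0 : ℝ) 1) ∩ ⋂ n, ⋂ (_ : n < N), {y | y n * (a n + y (n + 1)) = 1}
  have hcpt : IsCompact (Set.univ.pi fun _ : ℕ => Set.Icc (0 : ℝ) 1) :=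
    isCompact_univ_pi fun _ => isCompact_Icc
  have hcl : ∀ N, IsClosed (⋂ n, ⋂ (_ : n < N), {y : ℕ → ℝ | y n * (a n + y (n + 1)) = 1}) :=
    fun N => isClosed_iInter fun n => isClosed_iInter fun _ =>
      isClosed_eq (by fun_prop) continuous_const
  have hne : (⋂ N, S N).Nonempty := by
    refine IsCompact.nonempty_iInter_of_sequence_nonempty_isCompact_isClosed S ?_ ?_
      (hcpt.inter_right (hcl 0)) fun N => hcpt.isClosed.inter (hcl N)
    · refine fun N => Set.inter_subset_inter_right _ ?_
      intro y hy
      simp only [Set.mem_iInter] at hy ⊢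
      exact fun n hn => hy n (by lia)
    · intro N
      obtain ⟨y, hy, hy'⟩ := hfin N a ha
      refine ⟨y, fun n _ => hy n, ?_⟩
      simp only [Set.mem_iInter]
      exact hy'
  obtain ⟨y, hy⟩ := hne
  rw [Set.mem_iInter] at hy
  refine ⟨y, fun n => (hy 0).1 n trivial, fun n => ?_⟩
  have := (hy (n + 1)).2
  simp only [Set.mem_iInter] at this
  exact this n n.lt_succ_self

/-- All `y n` lie strictly between `0` and `1`, so `(y n)⁻¹ = a n + y (n + 1)` splits into integer
and fractional part. The continued fraction algorithm on `y 0` thus outputs the `a n` and never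
stops. -/
theorem exists_irrational_partialQuotient_eq (a : ℕ → ℕ) (ha : ∀ n, 1 ≤ a n) :
    ∃ θ : ℝ, θ ∈ Set.Ioo (0 : ℝ) 1 ∧ Irrational θ ∧ ∀ n, partialQuotient θ (n + 1) = a n := by
  obtain ⟨y, hy, hrec⟩ := exists_seq_eq_inv_add a ha
  have hpos : ∀ n, 0 < y n := fun n => (hy n).1.lt_of_ne' fun h => by
    have := hrec n
    rw [h, zero_mul] at this
    exact zero_ne_one this
  have hlt : ∀ n, y n < 1 := fun n => by
    have h1 : (1 : ℝ) ≤ a n := by exact_mod_cast ha n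
    nlinarith [hrec n, hpos n, hpos (n + 1)]
  have hfloor : ∀ (m : ℕ) (n : ℕ), ⌊(m : ℝ) + y n⌋ = m := fun m n => by
    rw [Int.floor_natCast_add, Int.floor_eq_zero_iff.2 ⟨(hpos n).le, hlt n⟩, add_zero]
  have hinv : ∀ n, (y n)⁻¹ = a n + y (n + 1) := fun n => inv_eq_of_mul_eq_one_right (hrec n)
  have hof : ∀ n, GenContFract.IntFractPair.of (y n)⁻¹ = ⟨(a n : ℤ), y (n + 1)⟩ := fun n => by
    rw [hinv, GenContFract.IntFractPair.of, hfloor, Int.fract, hfloor]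
    simp
  have hstream : ∀ n, GenContFract.IntFractPair.stream (y 0) (n + 1) =
      some ⟨(a n : ℤ), y (n + 1)⟩ := by
    intro n
    induction n with
    | zero =>
      have h0 : Int.fract (y 0) = y 0 := Int.fract_eq_self.2 ⟨(hpos 0).le, hlt 0⟩
      rw [GenContFract.IntFractPair.stream_succ (by rw [h0]; exact (hpos 0).ne'), h0,
        GenContFract.IntFractPair.stream_zero, hof]
    | succ n ih =>
      rw [GenContFract.IntFractPair.stream_succ_of_some ih (hpos _).ne', hof]
  refine ⟨y 0, ⟨hpos 0, hlt 0⟩, ?_, fun n => ?_⟩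
  · rintro ⟨r, hr⟩
    obtain ⟨n, hn⟩ := (GenContFract.terminates_iff_rat (y 0)).2 ⟨r, hr.symm⟩
    rw [← GenContFract.terminatedAt_iff_s_terminatedAt,
      GenContFract.of_terminatedAt_n_iff_succ_nth_intFractPair_stream_eq_none, hstream] at hn
    exact Option.some_ne_none _ hn
  · have := GenContFract.partDen_eq_s_b
      (GenContFract.get?_of_eq_some_of_succ_get?_intFractPair_stream (hstream n))
    simp [partialQuotient, this]

theorem eventually_natCast_le_rpow_loglog :
    ∀ᶠ k : ℕ in atTop, (k : ℝ) ≤ (k : ℝ) ^ Real.log (Real.log (k : ℝ)) := by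
  filter_upwards [tendsto_loglog_natCast.eventually_ge_atTop 1, eventually_ge_atTop 1] with k h h1
  have hk : (1 : ℝ) ≤ k := by exact_mod_cast h1
  calc (k : ℝ) = (k : ℝ) ^ (1 : ℝ) := (Real.rpow_one _).symm
    _ ≤ _ := Real.rpow_le_rpow_of_exponent_le hk h

theorem exists_partialQuotient_isEquivalent : ∃ θ : ℝ, θ ∈ Set.Ioo (0 : ℝ) 1 ∧ Irrational θ ∧
    (fun k : ℕ => partialQuotient θ k) ~[atTop]
      (fun k : ℕ => (k : ℝ) ^ Real.log (Real.log (k : ℝ))) := by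
  have htop : Tendsto (fun k : ℕ => (k : ℝ) ^ Real.log (Real.log (k : ℝ))) atTop atTop :=
    tendsto_atTop_mono' atTop eventually_natCast_le_rpow_loglog tendsto_natCast_atTop_atTop
  obtain ⟨θ, h01, hirr, hθ⟩ := exists_irrational_partialQuotient_eq
    -- Entry `n` prescribes `a_{n+1}`. The maximum repairs small indices such as `a_2`, where the
    -- floor is `0`.
    (fun n => max 1 ⌊((n + 1 : ℕ) : ℝ) ^ Real.log (Real.log ((n + 1 : ℕ) : ℝ))⌋₊)
    fun n => le_max_left _ _
  refine ⟨θ, h01, hirr, ?_⟩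
  refine (Asymptotics.isEquivalent_nat_floor.comp_tendsto htop).congr_left ?_
  filter_upwards [htop.eventually_ge_atTop 1, eventually_ge_atTop 1] with k h1 hk
  obtain ⟨n, rfl⟩ := Nat.exists_eq_add_of_le' hk
  rw [hθ, max_eq_right (Nat.one_le_floor_iff _ |>.2 h1)]
  rfl

/-! ### Partial quotients of size `k ^ (log log k)` -/

theorem tendsto_log_mul_loglog_natCast :
    Tendsto (fun k : ℕ => Real.log k * Real.log (Real.log k)) atTop atTop :=
  tendsto_log_natCast.atTop_mul_atTop₀ tendsto_loglog_natCast

/-- From `a_{k+1} q_k ≤ q_{k+1} ≤ (a_{k+1} + 1) q_k`, with `a_{k+1}` between `v / 2` and `3 v / 2`.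
The errors `log 2` are absorbed because `l = log v ≥ 2`. -/
theorem eventually_log_convDen_succ {θ : ℝ} (hθ : Irrational θ)
    (ha : (fun k : ℕ => partialQuotient θ k) ~[atTop]
      (fun k : ℕ => (k : ℝ) ^ Real.log (Real.log (k : ℝ)))) :
    ∀ᶠ k : ℕ in atTop,
      Real.log (convDen θ k) + Real.log (k + 1 : ℕ) * Real.log (Real.log (k + 1 : ℕ)) / 2 ≤
        Real.log (convDen θ (k + 1)) ∧
      Real.log (convDen θ (k + 1)) ≤ Real.log (convDen θ k) +
        3 * (Real.log (k + 1 : ℕ) * Real.log (Real.log (k + 1 : ℕ))) := by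
  have hb := (tendsto_add_atTop_nat 1).eventually
    (ha.isLittleO.bound (show (0 : ℝ) < 1 / 2 by norm_num))
  filter_upwards [hb,
    (tendsto_add_atTop_nat 1).eventually (tendsto_log_mul_loglog_natCast.eventually_ge_atTop 2)]
    with k hk hL
  have hk0 : (0 : ℝ) < (k + 1 : ℕ) := by positivity
  set v := ((k + 1 : ℕ) : ℝ) ^ Real.log (Real.log (k + 1 : ℕ)) with hv
  set l := Real.log (k + 1 : ℕ) * Real.log (Real.log (k + 1 : ℕ)) with hl
  have hv0 : 0 < v := Real.rpow_pos_of_pos hk0 _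
  have hlv : Real.log v = l := by rw [hv, Real.log_rpow hk0, mul_comm]
  rw [Pi.sub_apply, Real.norm_of_nonneg hv0.le, Real.norm_eq_abs, abs_le] at hk
  set p := partialQuotient θ (k + 1) with hp
  have hp1 : 1 ≤ p := by
    obtain ⟨b, hb1, -, -, hb⟩ := exists_nat_partialQuotient hθ k
    rw [hp, hb]
    exact_mod_cast hb1
  have hq0 : 0 < convDen θ k := one_pos.trans_le (one_le_convDen hθ k)
  have hq1 : 0 < convDen θ (k + 1) := one_pos.trans_le (one_le_convDen hθ _)
  have hlog2 : Real.log 2 < 1 := Real.log_two_lt_d9.trans (by norm_num)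
  constructor
  · have h1 : v / 2 * convDen θ k ≤ convDen θ (k + 1) :=
      le_trans (by gcongr; linarith [hk.1]) (partialQuotient_mul_convDen_le hθ k)
    have h2 := Real.log_le_log (by positivity) h1
    rw [Real.log_mul (by positivity) hq0.ne', Real.log_div hv0.ne' two_ne_zero, hlv] at h2
    linarith
  · have h1 : convDen θ (k + 1) ≤ 2 * (2 * v) * convDen θ k :=
      (convDen_succ_le hθ k).trans (by gcongr; linarith [hk.2])
    have h2 := Real.log_le_log hq1 h1
    rw [Real.log_mul (by positivity) hq0.ne', Real.log_mul two_ne_zero (by positivity),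
      Real.log_mul two_ne_zero hv0.ne', hlv] at h2
    linarith

theorem eventually_log_convDen_le {θ : ℝ} (hθ : Irrational θ)
    (ha : (fun k : ℕ => partialQuotient θ k) ~[atTop]
      (fun k : ℕ => (k : ℝ) ^ Real.log (Real.log (k : ℝ)))) :
    ∀ᶠ k : ℕ in atTop,
      Real.log (convDen θ k) ≤ 4 * (k * Real.log k * Real.log (Real.log k)) := by
  obtain ⟨K, hK⟩ := eventually_atTop.1 ((eventually_log_convDen_succ hθ ha).and
    (tendsto_natCast_atTop_atTop.eventually_ge_atTop (Real.exp (Real.exp 1))))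
  have hind : ∀ k, K ≤ k → Real.log (convDen θ k) ≤ Real.log (convDen θ K) +
      3 * (k - K) * (Real.log k * Real.log (Real.log k)) := by
    intro k hk
    induction k, hk using Nat.le_induction with
    | base => simp
    | succ k hk ih =>
      have h1 := (hK k hk).1.2
      have h2 := (hK k hk).2
      have hkk : (k : ℝ) ≤ (k + 1 : ℕ) := by exact_mod_cast k.le_succ
      have h3 := monotoneOn_log_mul_loglog (Set.mem_Ici.2 h2) (Set.mem_Ici.2 (h2.trans hkk)) hkk
      have h4 : (K : ℝ) ≤ k := by exact_mod_cast hk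
      have h5 := mul_le_mul_of_nonneg_left h3 (by linarith : 0 ≤ 3 * ((k : ℝ) - K))
      push_cast at h1 h5 ⊢
      linarith
  filter_upwards [eventually_ge_atTop K, tendsto_log_mul_loglog_natCast.eventually_ge_atTop 1,
    tendsto_natCast_atTop_atTop.eventually_ge_atTop (Real.log (convDen θ K))] with k h1 h2 h3
  have h4 := hind k h1
  have h5 : (0 : ℝ) ≤ K := by positivity
  have h6 : (0 : ℝ) ≤ k := by positivity
  nlinarith [mul_nonneg h5 (by linarith : 0 ≤ Real.log k * Real.log (Real.log k)),
    mul_le_mul_of_nonneg_left h2 h6]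

/-- Only the increments beyond `k / 2` are summed. There are at least `k / 2` of them, each at least
half of `log · log log` at `k / 2`, which is at least its value at `√k` and so a quarter of its
value at `k`; this gives `1 / 16`. -/
theorem eventually_le_log_convDen {θ : ℝ} (hθ : Irrational θ)
    (ha : (fun k : ℕ => partialQuotient θ k) ~[atTop]
      (fun k : ℕ => (k : ℝ) ^ Real.log (Real.log (k : ℝ)))) :
    ∀ᶠ k : ℕ in atTop,
      k * Real.log k * Real.log (Real.log k) / 16 ≤ Real.log (convDen θ k) := by
  obtain ⟨K, hK⟩ := eventually_atTop.1 ((eventually_log_convDen_succ hθ ha).and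
    (tendsto_natCast_atTop_atTop.eventually_ge_atTop (Real.exp (Real.exp 1))))
  have hind : ∀ m, K ≤ m → ∀ k, m ≤ k →
      (k - m) * (Real.log m * Real.log (Real.log m) / 2) ≤ Real.log (convDen θ k) := by
    intro m hm k hk
    induction k, hk using Nat.le_induction with
    | base => simpa using Real.log_nonneg (one_le_convDen hθ m)
    | succ k hk ih =>
      have h1 := (hK k (hm.trans hk)).1.1
      have h2 := (hK m hm).2
      have hmk : (m : ℝ) ≤ (k + 1 : ℕ) := by exact_mod_cast hk.trans k.le_succ
      have h3 := monotoneOn_log_mul_loglog (Set.mem_Ici.2 h2) (Set.mem_Ici.2 (h2.trans hmk)) hmk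
      push_cast at h1 h3 ⊢
      linarith
  filter_upwards [eventually_ge_atTop (2 * K), eventually_ge_atTop 16,
    (Real.tendsto_sqrt_atTop.comp tendsto_natCast_atTop_atTop).eventually_ge_atTop
      (Real.exp (Real.exp 1)),
    tendsto_log_natCast.eventually_gt_atTop 0,
    tendsto_loglog_natCast.eventually_ge_atTop 2] with k h1 h2 h3 h4 h5
  have hk16 : (16 : ℝ) ≤ k := by exact_mod_cast h2
  have h6 := hind (k / 2) (by lia) k (by lia)
  have hm1 : ((k / 2 : ℕ) : ℝ) ≤ k / 2 := Nat.cast_div_le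
  have hm2 : ((k : ℝ) - 1) / 2 ≤ (k / 2 : ℕ) := by
    have : k ≤ 2 * (k / 2) + 1 := by lia
    have : (k : ℝ) ≤ 2 * (k / 2 : ℕ) + 1 := by exact_mod_cast this
    linarith
  have hsq : √(k : ℝ) ≤ (k / 2 : ℕ) := by
    refine le_trans ?_ hm2
    exact Real.sqrt_le_iff.2 ⟨by linarith, by nlinarith⟩
  have h7 := monotoneOn_log_mul_loglog (Set.mem_Ici.2 h3) (Set.mem_Ici.2 (le_trans h3 hsq)) hsq
  have hlog2 : Real.log 2 < 1 := Real.log_two_lt_d9.trans (by norm_num)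
  simp only [Function.comp_apply] at h7
  rw [Real.log_sqrt (by positivity), Real.log_div h4.ne' two_ne_zero] at h7
  have h8 : Real.log k * Real.log (Real.log k) / 4 ≤
      Real.log (k / 2 : ℕ) * Real.log (Real.log (k / 2 : ℕ)) := by
    refine le_trans ?_ h7
    nlinarith
  calc _ = (k : ℝ) / 2 * (Real.log k * Real.log (Real.log k) / 4 / 2) := by ring
    _ ≤ (k - (k / 2 : ℕ)) *
        (Real.log (k / 2 : ℕ) * Real.log (Real.log (k / 2 : ℕ)) / 2) := by
      gcongr
      · linarith
      · linarith
    _ ≤ _ := h6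

theorem not_logDenSummable {θ : ℝ} (hθ : Irrational θ)
    (ha : (fun k : ℕ => partialQuotient θ k) ~[atTop]
      (fun k : ℕ => (k : ℝ) ^ Real.log (Real.log (k : ℝ)))) : ¬ LogDenSummable θ := by
  intro hs
  have hs' : Summable fun k => 1 / Real.log (convDen θ k) := (summable_nat_add_iff 2).1 hs
  refine not_summable_of_sub_le tendsto_logloglog_natCast ?_ (hs'.mul_left 4)
  filter_upwards [eventually_logloglog_succ_sub_le, eventually_log_convDen_le hθ ha,
    (Real.tendsto_log_atTop.comp (tendsto_convDen hθ)).eventually_gt_atTop 0] with k h1 h2 h3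
  refine h1.trans ?_
  simp only [Function.comp_apply] at h3
  have h4 : 0 < k * Real.log k * Real.log (Real.log k) := by linarith
  rw [mul_one_div, div_le_div_iff₀ h4 h3]
  linarith

theorem summable_one_div_log_convDen_mul {θ : ℝ} (hθ : Irrational θ)
    (ha : (fun k : ℕ => partialQuotient θ k) ~[atTop]
      (fun k : ℕ => (k : ℝ) ^ Real.log (Real.log (k : ℝ)))) :
    Summable fun k => 1 / (Real.log (convDen θ k) *
      Real.log (Real.log (Real.log (√(convDen θ k))))) := by
  refine Summable.of_norm_bounded_eventually_nat
    (g := fun k : ℕ => 32 * (1 / (k * Real.log k * Real.log (Real.log k) ^ 2)))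
    (summable_one_div_mul_log_mul_loglog_sq.mul_left 32) ?_
  filter_upwards [eventually_le_log_convDen hθ ha, tendsto_log_natCast.eventually_ge_atTop 1,
    tendsto_loglog_natCast.eventually_ge_atTop 2,
    tendsto_log_mul_loglog_natCast.eventually_ge_atTop 32, eventually_ge_atTop 1]
    with k h1 h2 h3 h4 h5
  have hk1 : (1 : ℝ) ≤ k := by exact_mod_cast h5
  have hlog2 : Real.log 2 < 1 := Real.log_two_lt_d9.trans (by norm_num)
  set L := Real.log (convDen θ k) with hL
  set l := Real.log (k : ℝ)
  set ll := Real.log l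
  -- Half of the lower bound `k * l * ll / 16` is at least `k` because `l * ll ≥ 32`.
  have h6 : (k : ℝ) ≤ Real.log (√(convDen θ k)) := by
    rw [Real.log_sqrt (zero_le_one.trans (one_le_convDen hθ k)), ← hL]
    nlinarith
  have h7 : ll ≤ Real.log (Real.log (Real.log (√(convDen θ k)))) := by
    have h8 : l ≤ Real.log (Real.log (√(convDen θ k))) := Real.log_le_log (by linarith) h6
    exact Real.log_le_log (by linarith) h8
  set w := Real.log (Real.log (Real.log (√(convDen θ k))))
  have h9 : (0 : ℝ) < k * l * ll / 16 := by positivity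
  have hL0 : 0 < L := h9.trans_le h1
  have hw0 : 0 < w := by linarith
  rw [Real.norm_of_nonneg (by positivity), mul_one_div, div_le_div_iff₀ (by positivity)
    (by positivity)]
  have := mul_le_mul h1 h7 (by linarith) hL0.le
  nlinarith [mul_pos hL0 hw0]

theorem exists_of_partialQuotient_isEquivalent {θ : ℝ} (hθ : Irrational θ)
    (ha : (fun k : ℕ => partialQuotient θ k) ~[atTop]
      (fun k : ℕ => (k : ℝ) ^ Real.log (Real.log (k : ℝ)))) :
    ∃ φ : ℕ → ℝ, IsIncreasingPos φ ∧ SeriesDiverges φ ∧ LiminfInfiniteAE θ φ := by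
  -- Beyond this threshold the triple logarithm is at least `1`.
  set c := Real.exp (Real.exp (Real.exp 1))
  have hc : ∀ x ∈ Set.Ici c, Real.exp (Real.exp 1) ≤ Real.log x ∧
      Real.exp 1 ≤ Real.log (Real.log x) ∧ 1 ≤ Real.log (Real.log (Real.log x)) := by
    intro x hx
    have h1 := Real.le_log_of_exp_le hx
    have h2 := Real.le_log_of_exp_le h1
    exact ⟨h1, h2, Real.le_log_of_exp_le h2⟩
  have hcc : Real.exp (Real.exp 1) ≤ c :=
    Real.exp_le_exp.2 ((lt_add_one _).le.trans (Real.add_one_le_exp _))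
  have hmono : MonotoneOn (fun x => Real.log (Real.log (Real.log x))) (Set.Ici c) := by
    intro x hx y hy hxy
    have h1 := Real.log_le_log ((Real.exp_pos _).trans_le hx) hxy
    have h2 := Real.log_le_log ((Real.exp_pos _).trans_le (hc x hx).1) h1
    exact Real.log_le_log ((Real.exp_pos _).trans_le (hc x hx).2.1) h2
  have hpos : ∀ x ∈ Set.Ici c, 0 < Real.log x * Real.log (Real.log x) := fun x hx =>
    mul_pos ((Real.exp_pos _).trans_le (hc x hx).1) ((Real.exp_pos _).trans_le (hc x hx).2.1)
  obtain ⟨φ, hφ, hinc⟩ := exists_isIncreasingPos (x₀ := c)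
    (F := fun x => Real.log x * Real.log (Real.log x) * Real.log (Real.log (Real.log x)))
    (by
      intro x hx y hy hxy
      exact mul_le_mul (monotoneOn_log_mul_loglog (Set.mem_Ici.2 (hcc.trans hx))
        (Set.mem_Ici.2 (hcc.trans hy)) hxy) (hmono hx hy hxy)
        (by linarith [(hc x hx).2.2]) (hpos y hy).le)
    (mul_pos (hpos c Set.self_mem_Ici)
      (by linarith [(hc c Set.self_mem_Ici).2.2]))
  refine ⟨φ, hinc, ?_, ?_⟩
  · refine seriesDiverges_of_sub_le (Real.tendsto_log_atTop.comp tendsto_logloglog_natCast) ?_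
    filter_upwards [hφ, eventually_loglogloglog_succ_sub_le] with n h1 h2
    rw [h1, ← mul_assoc, ← mul_assoc]
    exact h2
  · refine liminfInfiniteAE_of_summable_log hθ hinc hmono (fun x hx => ?_) (fun x hx => ?_) hφ
      (summable_one_div_log_convDen_mul hθ ha)
    · linarith [(hc x hx).2.2]
    · obtain ⟨h1, h2, -⟩ := hc x hx
      have h3 := Real.log_le_sub_one_of_pos ((Real.exp_pos _).trans_le h1)
      have h4 := Real.log_le_sub_one_of_pos ((Real.exp_pos _).trans_le h2)
      linarith

theorem proposition3 :
    -- the sufficient condition, with an explicit `φ`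
    (∀ θ : ℝ, Irrational θ → LogDenSummable θ →
      ∃ φ : ℕ → ℝ,
        (∀ᶠ n : ℕ in atTop, φ n = Real.log n * Real.log (Real.log n)) ∧
        IsIncreasingPos φ ∧ SeriesDiverges φ ∧ LiminfInfiniteAE θ φ) ∧
    -- the converse is not true
    (¬ ∀ θ : ℝ, Irrational θ →
      (∃ φ : ℕ → ℝ, IsIncreasingPos φ ∧ SeriesDiverges φ ∧ LiminfInfiniteAE θ φ) →
        LogDenSummable θ) ∧
    -- it fails for every `θ` with `a_k ~ k ^ (log (log k))`, and there are such `θ`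
    (∃ θ : ℝ, θ ∈ Set.Ioo (0 : ℝ) 1 ∧ Irrational θ ∧
      (fun k : ℕ => partialQuotient θ k) ~[atTop]
        (fun k : ℕ => (k : ℝ) ^ Real.log (Real.log (k : ℝ)))) ∧
    (∀ θ : ℝ, Irrational θ →
      (fun k : ℕ => partialQuotient θ k) ~[atTop]
        (fun k : ℕ => (k : ℝ) ^ Real.log (Real.log (k : ℝ))) →
      ¬ LogDenSummable θ ∧
      ∃ φ : ℕ → ℝ, IsIncreasingPos φ ∧ SeriesDiverges φ ∧ LiminfInfiniteAE θ φ) := by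
  refine ⟨fun θ hθ hs => exists_log_mul_loglog_of_logDenSummable hθ hs, fun h => ?_,
    exists_partialQuotient_isEquivalent, fun θ hθ ha =>
      ⟨not_logDenSummable hθ ha, exists_of_partialQuotient_isEquivalent hθ ha⟩⟩
  obtain ⟨θ, -, hθ, ha⟩ := exists_partialQuotient_isEquivalent
  exact not_logDenSummable hθ ha (h θ hθ (exists_of_partialQuotient_isEquivalent hθ ha))
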